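/- All vector lattices and algebras are real. A vector lattice is Dedekind complete if each nonempty subset that is bounded above has a supremum, and laterally complete if each nonempty set of pairwise disjoint positive elements has a supremum. A universal completion of a vector lattice $L$ is a vector lattice $L^u$ that is both Dedekind complete and laterally complete, and that contains $L$ (via an injective linear lattice homomorphism) as an order dense vector sublattice, i.e. for each $0<y\in L^u$ there is $x\in L$ with $0<x\le y$. An $f$-algebra is an associative algebra $A$ that is also a vector lattice, such that $ab\ge 0$ whenever $a,b\ge 0$, and such that $a\wedge b=0$ and $c\ge 0$ imply $(ac)\wedge b=(ca)\wedge b=0$. An element $e\ge 0$ of $L$ is a weak order unit if $|x|\wedge e=0$ implies $x=0$. A subalgebra is a vector subspace closed under multiplication. **Corollary.** Let $L$ be a Dedekind complete vector lattice with a weak order unit $e$, let $L^u$ be its universal completion, equipped with a multiplication that makes $L^u$ an $f$-algebra with multiplicative unit $e$, and let $L(e)=\{x\in L:\ |x|\le \mu e \text{ for some } \mu\in(0,\infty)\}$ be the principal order ideal of $L$ generated by $e$. Then every subalgebra of $L^u$ containing $L(e)$ is, with the order and the operations inherited from $L^u$, a Dedekind complete $f$-algebra with multiplicative unit $e$ (in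 particular it is a vector sublattice of $L^u$). This covers the following two cases. 1. Let $\mu$ be a $\sigma$-finite measure, let $L^0(\mu)$ be the algebra of all $\mu$-a.e. classes of real-valued measurable functions with its pointwise a.e. operations and order, and $L^\infty(\mu)$ the essentially bounded ones. Then $L^\infty(\mu)$ is a Dedekind complete vector lattice with weak order unit $1$, $L^0(\mu)$ is its universal completion and is an $f$-algebra with unit $1$, and every subalgebra of $L^0(\mu)$ containing $L^\infty(\mu)$ is a Dedekind complete $f$-algebra with multiplicative unit $1$. 2. Let $K$ be an extremally disconnected compact Hausdorff space, and let $C^\infty(K)$ be the set of all continuous functions $K\to[-\infty,\infty]$ that are finite on a dense subset of $K$, ordered pointwise; $f+g$, $fg$ and $rf$ ($r\in\mathbb R$) are the unique elements of $C^\infty(K)$ that agree with the pointwise sum, product and scalar multiple wherever the functions involved are finite. Then the space $C(K)$ of continuous functions $K\to\mathbb R$ is a Dedekind complete vector lattice with weak order unit $1$, $C^\infty(K)$ is its universal completion and is an $f$-algebra with unit $1$, and every subalgebra of $C^\infty(K)$ containing $C(K)$ is a Dedekind complete $f$-algebra with multiplicative unit $1$. -/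

import Mathlib

open Set Filter Topology MeasureTheory
open scoped ENNReal

noncomputable section

/-! ## Vector lattices and f-algebras -/

/-- A (real) vector lattice: a lattice-ordered real vector space. -/
class IsVectorLattice (L : Type*) [AddCommGroup L] [Module ℝ L] [Lattice L] : Prop
    extends IsOrderedAddMonoid L, IsOrderedModule ℝ L

/-- An f-algebra: an associative real algebra (not assumed unital or commutative) which is a vector
lattice, in which products of positive elements are positive, and in which `a ⊓ b = 0` implies
`(a * c) ⊓ b = (c * a) ⊓ b = 0` for all `c ≥ 0`. -/
class IsFAlgebra (A : Type*) [NonUnitalRing A] [Module ℝ A] [Lattice A] : Prop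
    extends IsVectorLattice A, IsScalarTower ℝ A A, SMulCommClass ℝ A A where
  mul_nonneg' : ∀ a b : A, 0 ≤ a → 0 ≤ b → 0 ≤ a * b
  inf_eq_zero : ∀ a b c : A, 0 ≤ c → a ⊓ b = 0 → (a * c) ⊓ b = 0 ∧ (c * a) ⊓ b = 0

/-- `u` is a (two-sided) multiplicative unit. -/
def IsMulUnit {A : Type*} [Mul A] (u : A) : Prop := ∀ x : A, u * x = x ∧ x * u = x

/-- Dedekind completeness: each nonempty subset that is bounded above has a supremum. -/
def IsDedekindComplete (L : Type*) [Preorder L] : Prop :=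
  ∀ S : Set L, S.Nonempty → BddAbove S → ∃ a, IsLUB S a

/-- Lateral completeness: each nonempty set of pairwise disjoint positive elements has a
supremum. -/
def IsLaterallyComplete (L : Type*) [AddCommGroup L] [Lattice L] : Prop :=
  ∀ S : Set L, S.Nonempty → (∀ a ∈ S, 0 ≤ a) → S.Pairwise (fun a b => a ⊓ b = 0) → ∃ a, IsLUB S a

/-- A weak order unit: a positive element `e` such that only `0` is disjoint from `e`. -/
def IsWeakOrderUnit {L : Type*} [AddCommGroup L] [Lattice L] (e : L) : Prop :=
  0 ≤ e ∧ ∀ x : L, |x| ⊓ e = 0 → x = 0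

/-- The principal order ideal `L(e) = {x | ∃ μ > 0, |x| ≤ μ |e|}`. -/
def principalIdeal {L : Type*} [AddCommGroup L] [Module ℝ L] [Lattice L] (e : L) : Set L :=
  {x | ∃ r : ℝ, 0 < r ∧ |x| ≤ r • |e|}

/-- `ι : L → M` exhibits `M` as the universal completion of `L`: `M` is a universally complete
(i.e. Dedekind complete and laterally complete) vector lattice, and `ι` is an injective lattice
homomorphism whose range is order dense in `M`. -/
structure IsUniversalCompletion {L M : Type*} [AddCommGroup L] [Module ℝ L] [Lattice L]
    [AddCommGroup M] [Module ℝ M] [Lattice M] (ι : L →ₗ[ℝ] M) : Prop where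
  isVectorLattice : IsVectorLattice M
  isDedekindComplete : IsDedekindComplete M
  isLaterallyComplete : IsLaterallyComplete M
  injective : Function.Injective ι
  map_sup : ∀ x y, ι (x ⊔ y) = ι x ⊔ ι y
  map_inf : ∀ x y, ι (x ⊓ y) = ι x ⊓ ι y
  orderDense : ∀ y : M, 0 < y → ∃ x : L, 0 < ι x ∧ ι x ≤ y

/-- The subalgebra `B` of `M`, with the operations and the order inherited from `M`, is a Dedekind
complete f-algebra (in particular a lattice) with multiplicative unit `u`. A subalgebra is not
assumed to contain a unit. -/
def IsDedekindCompleteFAlgebraWithUnit {M : Type*} [NonUnitalRing M] [Module ℝ M] [Lattice M]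
    (B : NonUnitalSubalgebra ℝ M) (u : M) : Prop :=
  ∃ (hsup : ∀ ⦃x y : M⦄, x ∈ B → y ∈ B → x ⊔ y ∈ B)
    (hinf : ∀ ⦃x y : M⦄, x ∈ B → y ∈ B → x ⊓ y ∈ B) (hu : u ∈ B),
    letI : Lattice B := Subtype.lattice hsup hinf
    IsFAlgebra B ∧ IsDedekindComplete B ∧ IsMulUnit (⟨u, hu⟩ : B)

/-! ## The algebra `L⁰(μ)`

`Ω →ₘ[μ] ℝ` carries Mathlib's pointwise a.e. order, sum, scalar multiple and product; only their
combination into a ring is recorded here. -/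

instance {Ω : Type*} [MeasurableSpace Ω] (μ : Measure Ω) : NonUnitalCommRing (Ω →ₘ[μ] ℝ) where
  __ := (inferInstance : AddCommGroup (Ω →ₘ[μ] ℝ))
  __ := (inferInstance : CommMonoid (Ω →ₘ[μ] ℝ))
  left_distrib f g h := AEEqFun.toGerm_injective (by
    simp only [AEEqFun.mul_toGerm, AEEqFun.add_toGerm, mul_add])
  right_distrib f g h := AEEqFun.toGerm_injective (by
    simp only [AEEqFun.mul_toGerm, AEEqFun.add_toGerm, add_mul])
  zero_mul f := AEEqFun.toGerm_injective (by
    simp only [AEEqFun.mul_toGerm, AEEqFun.zero_toGerm, zero_mul])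
  mul_zero f := AEEqFun.toGerm_injective (by
    simp only [AEEqFun.mul_toGerm, AEEqFun.zero_toGerm, mul_zero])

/-! ## `L^∞(μ)` inside `L⁰(μ)` -/

/-- The inclusion of `L^∞(μ)` into the space `L⁰(μ)` of classes of real measurable functions. -/
def linftyIncl {Ω : Type*} [MeasurableSpace Ω] (μ : Measure Ω) : Lp ℝ ∞ μ →ₗ[ℝ] (Ω →ₘ[μ] ℝ) where
  toFun f := f
  map_add' _ _ := rfl
  map_smul' _ _ := rfl

/-- The class of the constant function `1` in `L^∞(μ)`. -/
def linftyOne {Ω : Type*} [MeasurableSpace Ω] (μ : Measure Ω) : Lp ℝ ∞ μ :=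
  (memLp_top_const (1 : ℝ)).toLp (fun _ : Ω => (1 : ℝ))

/-! ## The algebra `C^∞(K)` for an extremally disconnected compact Hausdorff space -/

/-- `C^∞(K)`: continuous extended-real valued functions on `K` that are finite on a dense set. -/
def CInfty (K : Type*) [TopologicalSpace K] : Type _ :=
  {f : C(K, EReal) // Dense {x | f x ≠ ⊥ ∧ f x ≠ ⊤}}

namespace CInfty

section Order

variable {K : Type*} [TopologicalSpace K]

instance : CoeFun (CInfty K) (fun _ => K → EReal) := ⟨fun f => f.1⟩

/-- The open set where `f` is finite. -/
def fin (f : CInfty K) : Set K := {x | f x ≠ ⊥ ∧ f x ≠ ⊤}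

theorem dense_fin (f : CInfty K) : Dense f.fin := f.2

theorem isOpen_fin (f : CInfty K) : IsOpen f.fin :=
  (isOpen_ne.preimage f.1.continuous).inter (isOpen_ne.preimage f.1.continuous)

theorem coe_toReal {f : CInfty K} {x : K} (hx : x ∈ f.fin) : ((f x).toReal : EReal) = f x :=
  EReal.coe_toReal hx.2 hx.1

theorem dense_inter (f g : CInfty K) : Dense (f.fin ∩ g.fin) :=
  f.dense_fin.inter_of_isOpen_left g.dense_fin f.isOpen_fin

theorem continuousOn_toReal (f : CInfty K) : ContinuousOn (fun x => (f x).toReal) f.fin :=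
  EReal.continuousOn_toReal.comp f.1.continuous.continuousOn (fun x hx => by
    simpa [fin, not_or] using hx)

theorem ext_of_dense {f g : CInfty K} {U : Set K} (hU : Dense U) (h : ∀ x ∈ U, f x = g x) :
    f = g :=
  Subtype.ext (ContinuousMap.ext fun x => congrFun
    (f.1.continuous.ext_on hU g.1.continuous h) x)

/-- The order and the lattice operations of `C^∞(K)` are the pointwise ones. -/
instance : Lattice (CInfty K) :=
  Subtype.lattice
    (fun f g hf hg => (CInfty.dense_inter ⟨f, hf⟩ ⟨g, hg⟩).mono fun x hx => by
      change f x ⊔ g x ≠ ⊥ ∧ f x ⊔ g x ≠ ⊤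
      rcases le_total (f x) (g x) with h | h
      · rw [sup_eq_right.2 h]; exact hx.2
      · rw [sup_eq_left.2 h]; exact hx.1)
    (fun f g hf hg => (CInfty.dense_inter ⟨f, hf⟩ ⟨g, hg⟩).mono fun x hx => by
      change f x ⊓ g x ≠ ⊥ ∧ f x ⊓ g x ≠ ⊤
      rcases le_total (f x) (g x) with h | h
      · rw [inf_eq_left.2 h]; exact hx.1
      · rw [inf_eq_right.2 h]; exact hx.2)

theorem le_def {f g : CInfty K} : f ≤ g ↔ ∀ x, f x ≤ g x := Iff.rfl

theorem sup_apply (f g : CInfty K) (x : K) : (f ⊔ g) x = f x ⊔ g x := rfl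

theorem inf_apply (f g : CInfty K) (x : K) : (f ⊓ g) x = f x ⊓ g x := rfl

/-- A finite continuous function as an element of `C^∞(K)`. -/
def ofReal (g : C(K, ℝ)) : CInfty K :=
  ⟨⟨fun x => (g x : EReal), continuous_coe_real_ereal.comp g.continuous⟩, by simp⟩

theorem ofReal_apply (g : C(K, ℝ)) (x : K) : ofReal g x = (g x : EReal) := rfl

/-- The filter of sets with dense interior. -/
def denseFilter (K : Type*) [TopologicalSpace K] : Filter K where
  sets := {S | Dense (interior S)}
  univ_sets := by simp
  sets_of_superset h hST := h.mono (interior_mono hST)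
  inter_sets h h' := by
    simpa only [mem_ofPred_eq, interior_inter] using h.inter_of_isOpen_left h' isOpen_interior

theorem mem_denseFilter {U : Set K} (ho : IsOpen U) (hd : Dense U) : U ∈ denseFilter K := by
  change Dense (interior U)
  rwa [ho.interior_eq]

/-- The germ, along the sets with dense interior, of the finite part of `f`. -/
def toGerm (f : CInfty K) : Germ (denseFilter K) ℝ := ((fun x => (f x).toReal : K → ℝ) : Germ _ ℝ)

theorem toGerm_injective : Function.Injective (toGerm (K := K)) := by
  intro f g h
  have h1 : (fun x => (f x).toReal) =ᶠ[denseFilter K] fun x => (g x).toReal := Germ.coe_eq.1 h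
  have h2 : {x | (f x).toReal = (g x).toReal} ∩ (f.fin ∩ g.fin) ∈ denseFilter K :=
    inter_mem h1 (mem_denseFilter (f.isOpen_fin.inter g.isOpen_fin) (f.dense_inter g))
  refine ext_of_dense (Dense.mono interior_subset h2) ?_
  rintro x ⟨hx, hf, hg⟩
  rw [← coe_toReal hf, ← coe_toReal hg]
  exact congrArg _ hx

end Order

variable {K : Type*} [TopologicalSpace K] [CompactSpace K] [T2Space K] [ExtremallyDisconnected K]

/-- A real function that is continuous on a dense open subset `U` of an extremally disconnected
compact Hausdorff space agrees on `U` with an element of `C^∞(K)`. -/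
theorem exists_extension {U : Set K} (hd : Dense U) {g : K → ℝ} (hg : ContinuousOn g U)
    (ho : IsOpen U) : ∃ F : CInfty K, ∀ x ∈ U, F x = (g x : EReal) := by
  let graph : Set (K × EReal) := (fun x => (x, (g x : EReal))) '' U
  let Γ : Set (K × EReal) := closure graph
  have hΓ : IsCompact Γ := isClosed_closure.isCompact
  have : CompactSpace Γ := isCompact_iff_compactSpace.1 hΓ
  have hpc : Continuous (fun p : Γ => p.1.1) := continuous_fst.comp continuous_subtype_val
  have hsurj : Function.Surjective (fun p : Γ => p.1.1) := by
    have hcl : IsClosed (range (fun p : Γ => p.1.1)) := (isCompact_range hpc).isClosed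
    have hsub : U ⊆ range (fun p : Γ => p.1.1) := fun x hx =>
      ⟨⟨(x, (g x : EReal)), subset_closure ⟨x, hx, rfl⟩⟩, rfl⟩
    rw [← range_eq_univ, ← univ_subset_iff, ← hd.closure_eq]
    exact closure_minimal hsub hcl
  obtain ⟨s, hs, hps⟩ := CompactT2.ExtremallyDisconnected.projective (A := K)
    (continuous_id (X := K)) hpc hsurj
  have hfst : ∀ x, (s x).1.1 = x := fun x => congrFun hps x
  have hval : ∀ x ∈ U, (s x).1.2 = (g x : EReal) := by
    intro x hx
    have hmem : (s x).1 ∈ closure graph := (s x).2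
    obtain ⟨u, hu, hux⟩ := mem_closure_iff_ultrafilter.1 hmem
    have h1 : Tendsto Prod.fst (u : Filter (K × EReal)) (𝓝 x) := by
      have := (continuous_fst.tendsto (s x).1).mono_left hux
      rwa [hfst] at this
    have h2 : Tendsto Prod.snd (u : Filter (K × EReal)) (𝓝 (s x).1.2) :=
      (continuous_snd.tendsto (s x).1).mono_left hux
    have h3 : Tendsto (fun p : K × EReal => (g p.1 : EReal)) u (𝓝 (g x : EReal)) :=
      ((continuous_coe_real_ereal.tendsto _).comp
        (hg.continuousAt (ho.mem_nhds hx)).tendsto).comp h1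
    refine tendsto_nhds_unique (h2.congr' ?_) h3
    filter_upwards [hu]
    rintro _ ⟨y, _, rfl⟩
    rfl
  refine ⟨⟨⟨fun x => (s x).1.2, continuous_snd.comp (continuous_subtype_val.comp hs)⟩,
    hd.mono fun x hx => ?_⟩, hval⟩
  change (s x).1.2 ≠ ⊥ ∧ (s x).1.2 ≠ ⊤
  rw [hval x hx]
  simp

theorem exists_add (f g : CInfty K) : ∃ F : CInfty K, ∀ x ∈ f.fin ∩ g.fin,
    F x = (((f x).toReal + (g x).toReal : ℝ) : EReal) :=
  exists_extension (f.dense_inter g) ((f.continuousOn_toReal.mono inter_subset_left).add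
    (g.continuousOn_toReal.mono inter_subset_right)) (f.isOpen_fin.inter g.isOpen_fin)

theorem exists_mul (f g : CInfty K) : ∃ F : CInfty K, ∀ x ∈ f.fin ∩ g.fin,
    F x = (((f x).toReal * (g x).toReal : ℝ) : EReal) :=
  exists_extension (f.dense_inter g) ((f.continuousOn_toReal.mono inter_subset_left).mul
    (g.continuousOn_toReal.mono inter_subset_right)) (f.isOpen_fin.inter g.isOpen_fin)

theorem exists_smul (r : ℝ) (f : CInfty K) : ∃ F : CInfty K, ∀ x ∈ f.fin,
    F x = ((r * (f x).toReal : ℝ) : EReal) :=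
  exists_extension f.dense_fin (continuousOn_const.mul f.continuousOn_toReal) f.isOpen_fin

instance : Zero (CInfty K) := ⟨ofReal 0⟩

/-- `f + g` is the unique element with `(f + g)(x) = f(x) + g(x)` where both are finite. -/
instance : Add (CInfty K) := ⟨fun f g => (exists_add f g).choose⟩

/-- `f * g` is the unique element with `(f * g)(x) = f(x) g(x)` where both are finite. -/
instance : Mul (CInfty K) := ⟨fun f g => (exists_mul f g).choose⟩

/-- `r • f` is the unique element with `(r • f)(x) = r f(x)` where `f` is finite. -/
instance : SMul ℝ (CInfty K) := ⟨fun r f => (exists_smul r f).choose⟩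

theorem add_apply {f g : CInfty K} {x : K} (hx : x ∈ f.fin ∩ g.fin) :
    (f + g) x = (((f x).toReal + (g x).toReal : ℝ) : EReal) := (exists_add f g).choose_spec x hx

theorem mul_apply {f g : CInfty K} {x : K} (hx : x ∈ f.fin ∩ g.fin) :
    (f * g) x = (((f x).toReal * (g x).toReal : ℝ) : EReal) := (exists_mul f g).choose_spec x hx

theorem smul_apply {r : ℝ} {f : CInfty K} {x : K} (hx : x ∈ f.fin) :
    (r • f) x = ((r * (f x).toReal : ℝ) : EReal) := (exists_smul r f).choose_spec x hx

theorem toGerm_zero : toGerm (0 : CInfty K) = 0 :=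
  rfl

theorem toGerm_add (f g : CInfty K) : toGerm (f + g) = toGerm f + toGerm g := by
  refine Germ.coe_eq.2 ?_
  filter_upwards [mem_denseFilter (f.isOpen_fin.inter g.isOpen_fin) (f.dense_inter g)] with x hx
  simp only [add_apply hx, EReal.toReal_coe]

theorem toGerm_mul (f g : CInfty K) : toGerm (f * g) = toGerm f * toGerm g := by
  refine Germ.coe_eq.2 ?_
  filter_upwards [mem_denseFilter (f.isOpen_fin.inter g.isOpen_fin) (f.dense_inter g)] with x hx
  simp only [mul_apply hx, EReal.toReal_coe]

theorem toGerm_smul (r : ℝ) (f : CInfty K) : toGerm (r • f) = r • toGerm f := by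
  refine Germ.coe_eq.2 ?_
  filter_upwards [mem_denseFilter f.isOpen_fin f.dense_fin] with x hx
  simp only [smul_apply hx, EReal.toReal_coe]
  rfl

instance : Neg (CInfty K) := ⟨fun f => (-1 : ℝ) • f⟩
instance : Sub (CInfty K) := ⟨fun f g => f + -g⟩
instance : SMul ℕ (CInfty K) := ⟨fun n f => (n : ℝ) • f⟩
instance : SMul ℤ (CInfty K) := ⟨fun n f => (n : ℝ) • f⟩

theorem toGerm_neg (f : CInfty K) : toGerm (-f) = -toGerm f :=
  (toGerm_smul _ f).trans (neg_one_smul ℝ _)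

instance : NonUnitalCommRing (CInfty K) :=
  toGerm_injective.nonUnitalCommRing toGerm toGerm_zero toGerm_add toGerm_mul toGerm_neg
    (fun f g => by
      rw [sub_eq_add_neg, ← toGerm_neg, ← toGerm_add]
      rfl)
    (fun n f => (toGerm_smul _ f).trans (Nat.cast_smul_eq_nsmul ℝ n _))
    (fun n f => (toGerm_smul _ f).trans (Int.cast_smul_eq_zsmul ℝ n _))

instance : Module ℝ (CInfty K) :=
  toGerm_injective.module ℝ
    { toFun := toGerm, map_zero' := toGerm_zero, map_add' := toGerm_add } toGerm_smul

/-- The inclusion of `C(K)` into `C^∞(K)`. -/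
def incl (K : Type*) [TopologicalSpace K] [CompactSpace K] [T2Space K] [ExtremallyDisconnected K] :
    C(K, ℝ) →ₗ[ℝ] CInfty K where
  toFun := ofReal
  map_add' f g := toGerm_injective (toGerm_add (ofReal f) (ofReal g)).symm
  map_smul' r f := toGerm_injective (toGerm_smul r (ofReal f)).symm

end CInfty

end

/-!
The heart of the matter is a division property: in a Dedekind complete f-algebra with unit `u`,
`0 ≤ x ≤ y` implies `x = c * y` for some `0 ≤ c ≤ u` (`IsFAlgebra.exists_mul_eq_of_le`). The factor
`c` is the supremum of all `c ∈ [0, u]` with `c * y ≤ x`. It satisfies `c * y ≤ x` because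
multiplication by `y` is order continuous, by the estimate `2 n y ≤ n² u + y²`
(`IsFAlgebra.mul_le_of_isLUB`). If the remainder `d = x - c * y` were nonzero, then, on the part
where `n d > y` for a suitable `n`, `c` could be enlarged (`IsFAlgebra.exists_mul_le_of_le_mul`).

A subalgebra `B` containing `[0, u]` is therefore closed under passing to `x` with `0 ≤ x ≤ y ∈ B`,
and also under positive parts: if `c * |y| = y⁺` with `0 ≤ c ≤ u`, then `c * y⁻` is below both `y⁺`
and `y⁻`, so `c * y⁻ = 0` and `y⁺ = c * y`. Hence `B` is an order ideal and inherits Dedekind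
completeness. When `L` is Dedekind complete it is an order ideal in `L^u`
(`IsUniversalCompletion.exists_eq_of_le`), so that a subalgebra containing the image of `L(e)`
contains `[0, e]`.

For the two function algebras it remains to see that they are f-algebras, which is checked
pointwise along the filter of conull sets or of sets with dense interior
(`IsFAlgebra.of_eventually`), that they are Dedekind and laterally complete, and that `L^∞(μ)` and
`C(K)` are order convex in them (`IsFAlgebra.isUniversalCompletion_of_ordConnected`). In `L⁰(μ)`
suprema are computed from a sequence that maximizes a finite integral; in `C^∞(K)` the closures
`A t` of the sets where some member exceeds `t` are clopen, and `x ↦ sup {t | x ∈ A t}` is the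
supremum. A disjoint family has at most one nonzero member almost everywhere, respectively at every
point, so its supremum is finite almost everywhere, respectively on a dense set.
-/

/-! ### Archimedean vector lattices -/

/-- A Dedekind complete vector lattice is Archimedean. -/
theorem IsDedekindComplete.nonpos_of_forall_nsmul_le {L : Type*} [AddCommGroup L] [Lattice L]
    [IsOrderedAddMonoid L] (hD : IsDedekindComplete L) {d y : L} (h : ∀ n : ℕ, n • d ≤ y) :
    d ≤ 0 := by
  obtain ⟨a, ha⟩ := hD (range fun n : ℕ => n • d) (range_nonempty _)
    ⟨y, by rintro _ ⟨n, rfl⟩; exact h n⟩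
  have : a ≤ a - d := ha.2 (by
    rintro _ ⟨n, rfl⟩
    have h1 : (n + 1) • d ≤ a := ha.1 ⟨n + 1, rfl⟩
    rw [succ_nsmul] at h1
    exact le_sub_iff_add_le.2 h1)
  simpa using this

/-! ### Unital f-algebras -/

namespace IsFAlgebra

variable {M : Type*} [NonUnitalRing M] [Module ℝ M] [Lattice M] [IsFAlgebra M]

instance : PosMulMono M where
  mul_le_mul_of_nonneg_left a ha b c hbc := by
    have := mul_nonneg' a (c - b) ha (sub_nonneg.2 hbc)
    rwa [mul_sub, sub_nonneg] at this

instance : MulPosMono M where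
  mul_le_mul_of_nonneg_right a ha b c hbc := by
    have := mul_nonneg' (c - b) a (sub_nonneg.2 hbc) ha
    rwa [sub_mul, sub_nonneg] at this

theorem mul_eq_zero_of_inf_eq_zero {a b : M} (h : a ⊓ b = 0) : a * b = 0 := by
  have ha : 0 ≤ a := h ▸ inf_le_left
  have hb : 0 ≤ b := h ▸ inf_le_right
  have h1 := (inf_eq_zero a b b hb h).1
  rw [inf_comm] at h1
  simpa using (inf_eq_zero b (a * b) a ha h1).2

theorem posPart_mul_negPart (a : M) : a⁺ * a⁻ = 0 :=
  mul_eq_zero_of_inf_eq_zero (posPart_inf_negPart_eq_zero a)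

theorem negPart_mul_posPart (a : M) : a⁻ * a⁺ = 0 :=
  mul_eq_zero_of_inf_eq_zero (by rw [inf_comm]; exact posPart_inf_negPart_eq_zero a)

protected theorem mul_self_nonneg (a : M) : 0 ≤ a * a := by
  have : a * a = a⁺ * a⁺ + a⁻ * a⁻ := by
    conv_lhs => rw [← posPart_sub_negPart a]
    rw [sub_mul, mul_sub, mul_sub, posPart_mul_negPart, negPart_mul_posPart]
    abel
  rw [this]
  exact add_nonneg (mul_nonneg (posPart_nonneg a) (posPart_nonneg a))
    (mul_nonneg (negPart_nonneg a) (negPart_nonneg a))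

theorem unit_nonneg {u : M} (hu : IsMulUnit u) : 0 ≤ u :=
  (hu u).1 ▸ IsFAlgebra.mul_self_nonneg u

/-- The quadratic estimate `2ny ≤ n² u + y²`, obtained from `(y - nu)² ≥ 0`. -/
theorem two_smul_le_sq_add {u : M} (hu : IsMulUnit u) (y : M) (r : ℝ) :
    (2 * r) • y ≤ (r ^ 2) • u + y * y := by
  have h := IsFAlgebra.mul_self_nonneg (y - r • u)
  have e : (y - r • u) * (y - r • u) = (r ^ 2) • u + y * y - (2 * r) • y := by
    simp only [sub_mul, mul_sub, smul_mul_assoc, mul_smul_comm, (hu _).1, (hu _).2]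
    module
  rwa [e, sub_nonneg] at h

/-- In a unital Archimedean f-algebra, positive elements with zero product are disjoint. -/
theorem inf_eq_zero_of_mul_eq_zero {u : M} (hD : IsDedekindComplete M) (hu : IsMulUnit u)
    {p w : M} (hp : 0 ≤ p) (hw : 0 ≤ w) (h : p * w = 0) : p ⊓ w = 0 := by
  have hv : 0 ≤ p ⊓ w := le_inf hp hw
  refine le_antisymm (hD.nonpos_of_forall_nsmul_le (y := u) fun n => ?_) hv
  have h0 : (p ⊓ w) * (p ⊓ w) = 0 := le_antisymm
    (h ▸ mul_le_mul inf_le_left inf_le_right hv hp) (mul_nonneg hv hv)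
  -- the quadratic estimate for `n (p ⊓ w)`, whose square vanishes
  have h1 := two_smul_le_sq_add hu ((n : ℝ) • (p ⊓ w)) 1
  rw [smul_mul_assoc, mul_smul_comm, h0, smul_zero, smul_zero, add_zero, one_pow, one_smul,
    mul_one, two_smul] at h1
  rw [← Nat.cast_smul_eq_nsmul ℝ]
  exact (le_add_of_nonneg_left (smul_nonneg n.cast_nonneg hv)).trans h1

/-- Multiplication by a positive element is order continuous: the inequality `c y ≤ x` passes to
suprema of sets of `c ∈ [0, u]`. -/
theorem mul_le_of_isLUB {u : M} (hD : IsDedekindComplete M) (hu : IsMulUnit u)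
    {C : Set M} {c x y : M} (hy : 0 ≤ y) (hc : IsLUB C c) (hC0 : ∀ a ∈ C, 0 ≤ a) (hcu : c ≤ u)
    (hC : ∀ a ∈ C, a * y ≤ x) : c * y ≤ x := by
  have hyy := IsFAlgebra.mul_self_nonneg y
  rw [← sub_nonpos]
  refine hD.nonpos_of_forall_nsmul_le (y := y * y) fun n => ?_
  rcases Nat.eq_zero_or_pos n with rfl | hn
  · simpa using hyy
  have hn' : (0 : ℝ) < n := by exact_mod_cast hn
  rw [← Nat.cast_smul_eq_nsmul ℝ]
  have key : ∀ a ∈ C, (n : ℝ) • (c * y - x) ≤ ((n : ℝ) ^ 2) • (c - a) + y * y := by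
    intro a ha
    have hca : 0 ≤ c - a := sub_nonneg.2 (hc.1 ha)
    have hca' : c - a ≤ u := (sub_le_self c (hC0 a ha)).trans hcu
    calc (n : ℝ) • (c * y - x) ≤ (n : ℝ) • ((c - a) * y) := by
          refine smul_le_smul_of_nonneg_left ?_ hn'.le
          rw [sub_mul]
          exact sub_le_sub_left (hC a ha) _
      _ = (c - a) * ((n : ℝ) • y) := by rw [mul_smul_comm]
      _ ≤ (c - a) * ((2 * (n : ℝ)) • y) :=
          mul_le_mul_of_nonneg_left (smul_le_smul_of_nonneg_right (by linarith) hy) hca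
      _ ≤ (c - a) * (((n : ℝ) ^ 2) • u + y * y) :=
          mul_le_mul_of_nonneg_left (two_smul_le_sq_add hu y n) hca
      _ = ((n : ℝ) ^ 2) • (c - a) + (c - a) * (y * y) := by
          rw [mul_add, mul_smul_comm, (hu _).2]
      _ ≤ ((n : ℝ) ^ 2) • (c - a) + y * y := by
          have := mul_le_mul_of_nonneg_right hca' hyy
          rw [(hu _).1] at this
          exact add_le_add_right this _
  -- `key` holds for all `a ∈ C`, so it gives an upper bound of `C`
  have h1 : c ≤ c - ((n : ℝ) ^ 2)⁻¹ • ((n : ℝ) • (c * y - x) - y * y) := by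
    refine hc.2 fun a ha => ?_
    rw [le_sub_comm, inv_smul_le_iff_of_pos (by positivity), sub_le_iff_le_add]
    exact key a ha
  have h2 : ((n : ℝ) ^ 2)⁻¹ • ((n : ℝ) • (c * y - x) - y * y) ≤ 0 := by simpa using h1
  rw [inv_smul_le_iff_of_pos (by positivity), smul_zero, sub_nonpos] at h2
  exact h2

/-- If `0 < d ≤ g y`, then some nonzero `q` with `0 ≤ q ≤ g` satisfies `q y ≤ d`. -/
theorem exists_mul_le_of_le_mul {u : M} (hD : IsDedekindComplete M) (hu : IsMulUnit u)
    {d g y : M} (hd : 0 ≤ d) (hd0 : d ≠ 0) (hg : 0 ≤ g) (hy : 0 ≤ y) (hdg : d ≤ g * y) :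
    ∃ q, 0 ≤ q ∧ q ≠ 0 ∧ q ≤ g ∧ q * y ≤ d := by
  obtain ⟨n, hn⟩ : ∃ n : ℕ, ¬ n • d ≤ y := by
    by_contra! h
    exact hd0 (le_antisymm (hD.nonpos_of_forall_nsmul_le h) hd)
  have hn0 : 0 < n := Nat.pos_of_ne_zero (by rintro rfl; simp [hy] at hn)
  have hn' : (0 : ℝ) < n := by exact_mod_cast hn0
  rw [← Nat.cast_smul_eq_nsmul ℝ] at hn
  -- `p` lives on the part where `n d > y`, so that `p y ≤ n p d`
  set v : M := (n : ℝ) • d - y with hv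
  set p : M := v⁺ ⊓ u with hpdef
  have hu0 := unit_nonneg hu
  have hp : 0 ≤ p := le_inf (posPart_nonneg v) hu0
  have hpneg : p * v⁻ = 0 := le_antisymm
    (posPart_mul_negPart v ▸ mul_le_mul_of_nonneg_right inf_le_left (negPart_nonneg v))
    (mul_nonneg hp (negPart_nonneg v))
  have hpv : p * v = p * v⁺ := by
    conv_lhs => rw [← posPart_sub_negPart v, mul_sub, hpneg, sub_zero]
  have hpv' : (n : ℝ) • (p * d) - p * y = p * v⁺ := by
    rw [← hpv, hv, mul_sub, mul_smul_comm]
  have hpy : p * y ≤ (n : ℝ) • (p * d) := by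
    rw [← sub_nonneg, hpv']
    exact mul_nonneg hp (posPart_nonneg v)
  have hp1 : 0 ≤ (n : ℝ)⁻¹ • p := smul_nonneg (by positivity) hp
  refine ⟨((n : ℝ)⁻¹ • p) ⊓ g, le_inf hp1 hg, fun hq => ?_, inf_le_right, ?_⟩
  · have h1 : p * g = 0 := by
      have := mul_eq_zero_of_inf_eq_zero hq
      rw [smul_mul_assoc] at this
      exact (smul_eq_zero.1 this).resolve_left (by positivity)
    have h2 : p * d = 0 := by
      refine le_antisymm ?_ (mul_nonneg hp hd)
      calc p * d ≤ p * (g * y) := mul_le_mul_of_nonneg_left hdg hp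
        _ = 0 := by rw [← mul_assoc, h1, zero_mul]
    have h3 : p * v⁺ = 0 := by
      refine le_antisymm ?_ (mul_nonneg hp (posPart_nonneg v))
      rw [← hpv', h2, smul_zero, zero_sub, neg_nonpos]
      exact mul_nonneg hp hy
    have h4 : p = 0 := by
      have := inf_eq_zero_of_mul_eq_zero hD hu hp (posPart_nonneg v) h3
      rwa [inf_eq_left.2 (inf_le_left : p ≤ v⁺)] at this
    have h5 : v⁺ = 0 := by
      have := mul_eq_zero_of_inf_eq_zero h4
      rwa [(hu _).2] at this
    exact hn (sub_nonpos.1 (posPart_eq_zero.1 h5))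
  · calc (((n : ℝ)⁻¹ • p) ⊓ g) * y ≤ ((n : ℝ)⁻¹ • p) * y :=
          mul_le_mul_of_nonneg_right inf_le_left hy
      _ = (n : ℝ)⁻¹ • (p * y) := smul_mul_assoc _ _ _
      _ ≤ p * d := (inv_smul_le_iff_of_pos hn').2 hpy
      _ ≤ u * d := mul_le_mul_of_nonneg_right inf_le_right hd
      _ = d := (hu d).1

/-- Division in a Dedekind complete unital f-algebra: if `0 ≤ x ≤ y` then `x = c y` for some
`c` between `0` and the unit. -/
theorem exists_mul_eq_of_le {u : M} (hD : IsDedekindComplete M) (hu : IsMulUnit u)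
    {x y : M} (hx : 0 ≤ x) (hxy : x ≤ y) : ∃ c, 0 ≤ c ∧ c ≤ u ∧ c * y = x := by
  have hy := hx.trans hxy
  have hu0 := unit_nonneg hu
  let C : Set M := {c | 0 ≤ c ∧ c ≤ u ∧ c * y ≤ x}
  have h0 : (0 : M) ∈ C := ⟨le_rfl, hu0, by simpa using hx⟩
  obtain ⟨c, hc⟩ := hD C ⟨0, h0⟩ ⟨u, fun a ha => ha.2.1⟩
  have hcu : c ≤ u := hc.2 fun a ha => ha.2.1
  have hc0 : 0 ≤ c := hc.1 h0
  have hcy : c * y ≤ x :=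
    mul_le_of_isLUB hD hu hy hc (fun a ha => ha.1) hcu (fun a ha => ha.2.2)
  refine ⟨c, hc0, hcu, ?_⟩
  by_contra hne
  obtain ⟨q, hq0, hqne, hqg, hqy⟩ := exists_mul_le_of_le_mul hD hu (d := x - c * y) (g := u - c)
    (sub_nonneg.2 hcy) (fun h => hne (sub_eq_zero.1 h).symm) (sub_nonneg.2 hcu) hy
    (by rw [sub_mul, (hu y).1]; exact sub_le_sub_right hxy _)
  -- `c + q` contradicts the maximality of `c`
  have : c + q ≤ c := hc.1 ⟨add_nonneg hc0 hq0, by rwa [add_comm, ← le_sub_iff_add_le],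
    by rwa [add_mul, add_comm, ← le_sub_iff_add_le]⟩
  exact hqne (le_antisymm (by simpa using this) hq0)

/-! ### Subalgebras containing the ideal generated by the unit -/

section Subalgebra

variable {u : M} (hD : IsDedekindComplete M) (hu : IsMulUnit u) (B : NonUnitalSubalgebra ℝ M)
  (hB : ∀ c, 0 ≤ c → c ≤ u → c ∈ B)
include hD hu hB

/-- The positive part of `y` is a multiple `c y` with `0 ≤ c ≤ u`: a factor `c` with
`c |y| = y⁺` annihilates `y⁻`. -/
theorem posPart_mem {y : M} (hy : y ∈ B) : y⁺ ∈ B := by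
  have habs := posPart_add_negPart y
  obtain ⟨c, hc0, hcu, hc⟩ := exists_mul_eq_of_le hD hu (posPart_nonneg y)
    (habs ▸ le_add_of_nonneg_right (negPart_nonneg y) : y⁺ ≤ |y|)
  rw [← habs, mul_add] at hc
  have h1 : c * y⁻ = 0 := by
    have h0 : 0 ≤ c * y⁻ := mul_nonneg hc0 (negPart_nonneg y)
    refine le_antisymm ?_ h0
    rw [← posPart_inf_negPart_eq_zero y]
    refine le_inf (hc ▸ le_add_of_nonneg_left (mul_nonneg hc0 (posPart_nonneg y))) ?_
    simpa only [(hu _).1] using mul_le_mul_of_nonneg_right hcu (negPart_nonneg y)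
  have h2 : c * y = y⁺ := by
    rw [h1, add_zero] at hc
    conv_lhs => rw [← posPart_sub_negPart y, mul_sub, h1, hc, sub_zero]
  exact h2 ▸ B.mul_mem (hB c hc0 hcu) hy

theorem sup_mem {x y : M} (hx : x ∈ B) (hy : y ∈ B) : x ⊔ y ∈ B := by
  have : x ⊔ y = (x - y)⁺ + y := by
    rw [posPart_def, sup_add, sub_add_cancel, zero_add]
  exact this ▸ add_mem (posPart_mem hD hu B hB (sub_mem hx hy)) hy

theorem inf_mem {x y : M} (hx : x ∈ B) (hy : y ∈ B) : x ⊓ y ∈ B := by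
  have : x ⊓ y = x + y - x ⊔ y := by rw [← inf_add_sup x y, add_sub_cancel_right]
  exact this ▸ sub_mem (add_mem hx hy) (sup_mem hD hu B hB hx hy)

theorem mem_of_nonneg_of_le {x y : M} (hx : 0 ≤ x) (hxy : x ≤ y) (hy : y ∈ B) : x ∈ B := by
  obtain ⟨c, hc0, hcu, rfl⟩ := exists_mul_eq_of_le hD hu hx hxy
  exact B.mul_mem (hB c hc0 hcu) hy

/-- A subalgebra of a Dedekind complete f-algebra with unit `u` that contains the order interval
`[0, u]` is an order ideal, hence a Dedekind complete f-algebra with unit `u`. -/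
theorem isDedekindCompleteFAlgebraWithUnit : IsDedekindCompleteFAlgebraWithUnit B u := by
  refine ⟨fun x y => sup_mem hD hu B hB, fun x y => inf_mem hD hu B hB,
    hB u (unit_nonneg hu) le_rfl, ?_⟩
  let _ : Lattice B := Subtype.lattice (fun x y => sup_mem hD hu B hB)
    (fun x y => inf_mem hD hu B hB)
  refine ⟨?_, ?_, fun x => ⟨Subtype.ext (hu x).1, Subtype.ext (hu x).2⟩⟩
  · exact
      { add_le_add_left := fun a b h c => add_le_add_left (α := M) h c
        smul_le_smul_of_nonneg_left := fun r hr a b h => smul_le_smul_of_nonneg_left (β := M) h hr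
        smul_le_smul_of_nonneg_right := fun a ha r s h =>
          smul_le_smul_of_nonneg_right (β := M) h ha
        mul_nonneg' := fun a b ha hb => mul_nonneg' (A := M) a b ha hb
        inf_eq_zero := fun a b c hc h =>
          have := inf_eq_zero (A := M) a b c hc (congrArg Subtype.val h)
          ⟨Subtype.ext this.1, Subtype.ext this.2⟩ }
  · rintro S ⟨s, hs⟩ ⟨b, hb⟩
    obtain ⟨a, ha⟩ := hD (Subtype.val '' S) ⟨s, s, hs, rfl⟩
      ⟨b, by rintro _ ⟨t, ht, rfl⟩; exact hb ht⟩
    have hsa : s.1 ≤ a := ha.1 ⟨s, hs, rfl⟩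
    have hab : a ≤ b := ha.2 (by rintro _ ⟨t, ht, rfl⟩; exact hb ht)
    have hmem : a ∈ B := by
      have := mem_of_nonneg_of_le hD hu B hB (sub_nonneg.2 hsa) (sub_le_sub_right hab s.1)
        (sub_mem b.2 s.2)
      simpa using add_mem this s.2
    exact ⟨⟨a, hmem⟩, fun t ht => ha.1 ⟨t, ht, rfl⟩,
      fun t ht => ha.2 (by rintro _ ⟨r, hr, rfl⟩; exact ht hr)⟩

end Subalgebra

end IsFAlgebra

/-! ### Order dense Dedekind complete sublattices -/

theorem IsUniversalCompletion.map_le_map_iff {L M : Type*} [AddCommGroup L] [Module ℝ L]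
    [Lattice L] [AddCommGroup M] [Module ℝ M] [Lattice M] {ι : L →ₗ[ℝ] M}
    (hι : IsUniversalCompletion ι) {a b : L} : ι a ≤ ι b ↔ a ≤ b := by
  rw [← inf_eq_left, ← hι.map_inf, hι.injective.eq_iff, inf_eq_left]

/-- A Dedekind complete vector lattice is an order ideal in its universal completion. -/
theorem IsUniversalCompletion.exists_eq_of_le {L M : Type*} [AddCommGroup L] [Module ℝ L]
    [Lattice L] [IsVectorLattice L] [AddCommGroup M] [Module ℝ M] [Lattice M] {ι : L →ₗ[ℝ] M}
    (hι : IsUniversalCompletion ι) (hL : IsDedekindComplete L) {x : L} {y : M} (hy : 0 ≤ y)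
    (hyx : y ≤ ι x) : ∃ s, ι s = y := by
  have := hι.isVectorLattice
  obtain ⟨s, hs⟩ := hL {z | ι z ≤ y} ⟨0, by simpa using hy⟩
    ⟨x, fun z hz => hι.map_le_map_iff.1 (le_trans hz hyx)⟩
  have hsy : ι s ≤ y := by
    by_contra hn
    obtain ⟨z, hz, hzs⟩ := hι.orderDense (ι s - y)⁺
      (lt_of_le_of_ne (posPart_nonneg _) fun h => hn (by
        rw [← sub_nonpos]; exact posPart_eq_zero.1 h.symm))
    -- `s - z` is a smaller upper bound, because `ι w ≤ ι s ⊓ y = ι s - (ι s - y)⁺`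
    have hub : s ≤ s - z := hs.2 fun w hw => by
      have h1 : (ι s - y)⁺ ≤ ι s - ι w := by
        rw [posPart_def]
        exact sup_le (sub_le_sub_left hw _) (sub_nonneg.2 (hι.map_le_map_iff.2 (hs.1 hw)))
      rw [le_sub_comm, ← hι.map_le_map_iff, map_sub]
      exact hzs.trans h1
    have hz0 : z ≤ 0 := by simpa using hub
    exact (hz.trans_le (hι.map_le_map_iff.2 hz0)).ne (map_zero ι).symm
  refine ⟨s, ?_⟩
  by_contra hne
  obtain ⟨z, hz, hzs⟩ := hι.orderDense (y - ι s)
    (sub_pos.2 (lt_of_le_of_ne hsy hne))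
  have hsz : s + z ≤ s := hs.1 (show ι (s + z) ≤ y by
    rw [map_add, add_comm, ← le_sub_iff_add_le]
    exact hzs)
  have hz0 : z ≤ 0 := by simpa using hsz
  exact (hz.trans_le (hι.map_le_map_iff.2 hz0)).ne (map_zero ι).symm

/-- Every subalgebra of a unital f-algebra structure on the universal completion that contains the
principal ideal of the unit is a Dedekind complete f-algebra. -/
theorem IsUniversalCompletion.isDedekindCompleteFAlgebraWithUnit {L : Type*} [AddCommGroup L]
    [Module ℝ L] [Lattice L] [IsVectorLattice L] {M : Type*} [NonUnitalRing M] [Module ℝ M]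
    [Lattice M] [IsFAlgebra M] {ι : L →ₗ[ℝ] M} {e : L} (hL : IsDedekindComplete L) (he : 0 ≤ e)
    (hι : IsUniversalCompletion ι) (hu : IsMulUnit (ι e)) (B : NonUnitalSubalgebra ℝ M)
    (hB : ∀ x ∈ principalIdeal e, ι x ∈ B) : IsDedekindCompleteFAlgebraWithUnit B (ι e) := by
  refine IsFAlgebra.isDedekindCompleteFAlgebraWithUnit hι.isDedekindComplete hu B
    fun c hc0 hce => ?_
  obtain ⟨s, rfl⟩ := hι.exists_eq_of_le hL hc0 hce
  rw [← map_zero ι, hι.map_le_map_iff] at hc0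
  refine hB s ⟨1, one_pos, ?_⟩
  rw [one_smul, abs_of_nonneg hc0, abs_of_nonneg he]
  exact hι.map_le_map_iff.1 hce

/-! ### Ideals of bounded elements -/

/-- A space `L` embedded as an order convex subspace of a Dedekind and laterally complete f-algebra
`M`, with the unit of `M` in its range, is Dedekind complete and has `M` as its universal
completion. Order density holds because `y ⊓ u` lies in `L` and is nonzero when `y > 0`. -/
theorem IsFAlgebra.isUniversalCompletion_of_ordConnected {L M : Type*} [AddCommGroup L]
    [Module ℝ L] [Lattice L] [NonUnitalRing M] [Module ℝ M] [Lattice M] [IsFAlgebra M]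
    {ι : L →ₗ[ℝ] M} {e : L} (hD : IsDedekindComplete M) (hLat : IsLaterallyComplete M)
    (hu : IsMulUnit (ι e)) (hle : ∀ {a b : L}, ι a ≤ ι b ↔ a ≤ b)
    (hconv : ∀ (a b : L) (y : M), ι a ≤ y → y ≤ ι b → ∃ x, ι x = y) :
    IsVectorLattice L ∧ IsDedekindComplete L ∧ IsWeakOrderUnit e ∧ IsUniversalCompletion ι := by
  have hu0 : 0 ≤ ι e := IsFAlgebra.unit_nonneg hu
  have hinj : Function.Injective ι := fun a b h =>
    le_antisymm (hle.1 h.le) (hle.1 h.ge)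
  have hsup : ∀ a b, ι (a ⊔ b) = ι a ⊔ ι b := fun a b => by
    have h : ι a ⊔ ι b ≤ ι (a ⊔ b) := sup_le (hle.2 le_sup_left) (hle.2 le_sup_right)
    obtain ⟨z, hz⟩ := hconv a (a ⊔ b) _ le_sup_left h
    refine le_antisymm ?_ h
    rw [← hz, hle]
    exact sup_le (hle.1 (hz ▸ le_sup_left)) (hle.1 (hz ▸ le_sup_right))
  have hinf : ∀ a b, ι (a ⊓ b) = ι a ⊓ ι b := fun a b => by
    have h : ι (a ⊓ b) ≤ ι a ⊓ ι b := le_inf (hle.2 inf_le_left) (hle.2 inf_le_right)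
    obtain ⟨z, hz⟩ := hconv (a ⊓ b) a _ h inf_le_left
    refine le_antisymm h ?_
    rw [← hz, hle]
    exact le_inf (hle.1 (hz ▸ inf_le_left)) (hle.1 (hz ▸ inf_le_right))
  refine ⟨?_, ?_, ⟨?_, ?_⟩, ?_⟩
  · exact
      { add_le_add_left := fun a b h c => by
          rw [← hle] at h ⊢
          simpa only [map_add] using add_le_add_left h (ι c)
        smul_le_smul_of_nonneg_left := fun r hr a b h => by
          rw [← hle] at h
          simpa only [← hle, map_smul] using smul_le_smul_of_nonneg_left h hr
        smul_le_smul_of_nonneg_right := fun a ha r s h => by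
          rw [← hle, map_zero] at ha
          simpa only [← hle, map_smul] using smul_le_smul_of_nonneg_right h ha }
  · rintro S ⟨s, hs⟩ ⟨b, hb⟩
    obtain ⟨y, hy⟩ := hD (ι '' S) ⟨ι s, s, hs, rfl⟩
      ⟨ι b, by rintro _ ⟨t, ht, rfl⟩; exact hle.2 (hb ht)⟩
    obtain ⟨x, rfl⟩ := hconv s b y (hy.1 ⟨s, hs, rfl⟩)
      (hy.2 (by rintro _ ⟨t, ht, rfl⟩; exact hle.2 (hb ht)))
    exact ⟨x, fun t ht => hle.1 (hy.1 ⟨t, ht, rfl⟩), fun t ht =>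
      hle.1 (hy.2 (by rintro _ ⟨r, hr, rfl⟩; exact hle.2 (ht hr)))⟩
  · rwa [← hle, map_zero]
  · intro x hx
    have h := congrArg ι hx
    rw [abs, hinf, hsup, map_neg, map_zero] at h
    have h1 := IsFAlgebra.mul_eq_zero_of_inf_eq_zero h
    rw [(hu _).2] at h1
    have h2 : ι x ≤ 0 := h1 ▸ le_sup_left
    have h3 : -ι x ≤ 0 := h1 ▸ le_sup_right
    exact hinj (by rw [map_zero]; exact le_antisymm h2 (neg_nonpos.1 h3))
  · refine ⟨inferInstance, hD, hLat, hinj, hsup, hinf, fun y hy => ?_⟩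
    have h0 : 0 ≤ y ⊓ ι e := le_inf hy.le hu0
    obtain ⟨x, hx⟩ := hconv 0 e (y ⊓ ι e) (by rwa [map_zero]) inf_le_right
    refine ⟨x, hx ▸ lt_of_le_of_ne h0 fun h => hy.ne' ?_, hx ▸ inf_le_left⟩
    have := IsFAlgebra.mul_eq_zero_of_inf_eq_zero h.symm
    rwa [(hu _).2] at this

/-! ### f-algebras of functions -/

/-- A space of real functions, identified and compared along a filter `l`, with the pointwise
operations, is an f-algebra. -/
theorem IsFAlgebra.of_eventually {A X : Type*} [NonUnitalRing A] [Module ℝ A] [Lattice A]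
    {l : Filter X} (φ : A → X → ℝ) (hle : ∀ {a b}, a ≤ b ↔ φ a ≤ᶠ[l] φ b)
    (hzero : φ 0 =ᶠ[l] 0) (hadd : ∀ a b, φ (a + b) =ᶠ[l] φ a + φ b)
    (hmul : ∀ a b, φ (a * b) =ᶠ[l] φ a * φ b) (hsmul : ∀ (r : ℝ) a, φ (r • a) =ᶠ[l] r • φ a)
    (hinf : ∀ a b, φ (a ⊓ b) =ᶠ[l] φ a ⊓ φ b) : IsFAlgebra A := by
  have hext : ∀ {a b}, φ a =ᶠ[l] φ b → a = b := fun h =>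
    le_antisymm (hle.2 h.le) (hle.2 h.symm.le)
  have hinf0 : ∀ {a b}, a ⊓ b = 0 ↔ ∀ᶠ x in l, φ a x ⊓ φ b x = 0 := fun {a b} => by
    constructor
    · intro h
      filter_upwards [hinf a b, hzero] with x h1 h2
      rw [h, h2] at h1
      exact h1.symm
    · intro h
      apply hext
      filter_upwards [hinf a b, hzero, h] with x h1 h2 h3
      rw [h1, h2]
      exact h3
  have hnonneg : ∀ {a}, 0 ≤ a ↔ ∀ᶠ x in l, 0 ≤ φ a x := fun {a} => by
    rw [hle]
    constructor <;> intro h <;> filter_upwards [h, hzero] with x h1 h2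
    · rwa [h2] at h1
    · rwa [h2]
  exact
    { add_le_add_left := fun a b h c => by
        rw [hle] at h ⊢
        filter_upwards [h, hadd a c, hadd b c] with x h1 h2 h3
        rw [h2, h3]
        exact add_le_add_left h1 _
      smul_le_smul_of_nonneg_left := fun r hr a b h => by
        simp only [hle] at h ⊢
        filter_upwards [h, hsmul r a, hsmul r b] with x h1 h2 h3
        rw [h2, h3]
        exact mul_le_mul_of_nonneg_left h1 hr
      smul_le_smul_of_nonneg_right := fun a ha r s h => by
        rw [hnonneg] at ha
        simp only [hle]
        filter_upwards [ha, hsmul r a, hsmul s a] with x h1 h2 h3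
        rw [h2, h3]
        exact mul_le_mul_of_nonneg_right h h1
      smul_assoc := fun r a b => by
        rw [smul_eq_mul, smul_eq_mul]
        apply hext
        filter_upwards [hmul (r • a) b, hsmul r a, hsmul r (a * b), hmul a b] with x h1 h2 h3 h4
        rw [h1, h3]
        simp only [Pi.mul_apply, Pi.smul_apply, h2, h4, smul_eq_mul, mul_assoc]
      smul_comm := fun r a b => by
        rw [smul_eq_mul, smul_eq_mul]
        apply hext
        filter_upwards [hmul a (r • b), hsmul r b, hsmul r (a * b), hmul a b] with x h1 h2 h3 h4
        rw [h1, h3]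
        simp only [Pi.mul_apply, Pi.smul_apply, h2, h4, smul_eq_mul, mul_left_comm]
      mul_nonneg' := fun a b ha hb => by
        rw [hnonneg] at ha hb ⊢
        filter_upwards [ha, hb, hmul a b] with x h1 h2 h3
        rw [h3]
        exact mul_nonneg h1 h2
      inf_eq_zero := fun a b c hc h => by
        rw [hnonneg] at hc
        rw [hinf0] at h
        have key : ∀ᶠ x in l, (φ a x * φ c x) ⊓ φ b x = 0 := by
          filter_upwards [hc, h] with x h1 h2
          have ha : 0 ≤ φ a x := h2 ▸ inf_le_left
          have hb : 0 ≤ φ b x := h2 ▸ inf_le_right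
          rcases le_total (φ a x) (φ b x) with h3 | h3
          · rw [inf_eq_left.2 h3] at h2
            rw [h2, zero_mul, inf_eq_left.2 hb]
          · rw [inf_eq_right.2 h3] at h2
            rw [h2, inf_eq_right.2 (mul_nonneg ha h1)]
        rw [hinf0, hinf0]
        constructor
        · filter_upwards [key, hmul a c] with x h1 h2
          rw [h2]
          exact h1
        · filter_upwards [key, hmul c a] with x h1 h2
          rw [h2, Pi.mul_apply, mul_comm]
          exact h1 }

/-! ### The f-algebra `L⁰(μ)` -/

namespace MeasureTheory.AEEqFun

variable {Ω : Type*} [MeasurableSpace Ω] {μ : Measure Ω}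

instance : IsFAlgebra (Ω →ₘ[μ] ℝ) :=
  IsFAlgebra.of_eventually (l := ae μ) (fun f => f) coeFn_le.symm coeFn_zero coeFn_add coeFn_mul
    coeFn_smul coeFn_inf

/-- A nonempty family in `L⁰(μ)` contains a sequence whose pointwise supremum dominates each member
of the family almost everywhere. The sequence maximizes the integral of `sup (2 + arctan t n)` with
respect to a finite measure equivalent to `μ`. -/
theorem exists_seq_forall_ae_le_iSup [SigmaFinite μ] {S : Set (Ω →ₘ[μ] ℝ)} (hS : S.Nonempty) :
    ∃ t : ℕ → Ω →ₘ[μ] ℝ, (∀ n, t n ∈ S) ∧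
      ∀ s ∈ S, ∀ᵐ x ∂μ, (s x : EReal) ≤ ⨆ n, (t n x : EReal) := by
  obtain ⟨ν, hν, hμν, -⟩ := exists_isFiniteMeasure_absolutelyContinuous μ
  let h : ℝ → ℝ≥0∞ := fun r => ENNReal.ofReal (2 + Real.arctan r)
  have hpos : ∀ r, 0 < 2 + Real.arctan r := fun r => by
    linarith [Real.neg_pi_div_two_lt_arctan r, Real.pi_lt_four]
  have hmono : StrictMono h := fun a b hab =>
    (ENNReal.ofReal_lt_ofReal_iff (hpos b)).2 (by linarith [Real.arctan_strictMono hab])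
  have hle : ∀ r, h r ≤ 4 := fun r => by
    rw [← ENNReal.ofReal_ofNat]
    exact ENNReal.ofReal_le_ofReal (by linarith [Real.arctan_lt_pi_div_two r, Real.pi_lt_four])
  have hmeas : ∀ f : Ω →ₘ[μ] ℝ, Measurable fun x => h (f x) := fun f =>
    (measurable_const.add (Real.measurable_arctan.comp f.measurable)).ennreal_ofReal
  let Φ : (ℕ → Ω →ₘ[μ] ℝ) → ℝ≥0∞ := fun t => ∫⁻ x, ⨆ n, h (t n x) ∂ν
  let V : Set ℝ≥0∞ := Φ '' {t | ∀ n, t n ∈ S}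
  obtain ⟨s₀, hs₀⟩ := hS
  have hVne : V.Nonempty := ⟨_, fun _ => s₀, fun _ => hs₀, rfl⟩
  obtain ⟨v, -, hv, hvV⟩ := exists_seq_tendsto_sSup hVne (OrderTop.bddAbove V)
  choose T hTS hT using hvV
  let t : ℕ → Ω →ₘ[μ] ℝ := fun n => T n.unpair.1 n.unpair.2
  have ht : ∀ n, t n ∈ S := fun n => hTS _ _
  have hsup : sSup V ≤ Φ t := by
    refine le_of_tendsto' hv fun k => ?_
    rw [← hT k]
    refine lintegral_mono' (μ := ν) le_rfl fun x : Ω => iSup_le fun m => ?_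
    refine le_iSup_of_le (Nat.pair k m) ?_
    simp only [t, Nat.unpair_pair, le_refl]
  refine ⟨t, ht, fun s hs => hμν.ae_le ?_⟩
  -- adjoining `s` to the sequence cannot increase the integral
  have hle_sup : ∀ x, (⨆ n, h (t n x)) ≤ h (s x) ⊔ ⨆ n, h (t n x) := fun x => le_sup_right
  have hint : ∫⁻ x, h (s x) ⊔ ⨆ n, h (t n x) ∂ν ≤ Φ t := by
    let t' : ℕ → Ω →ₘ[μ] ℝ := fun n => Nat.casesOn n s t
    have ht' : ∀ n, t' n ∈ S := by
      rintro (_ | n)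
      exacts [hs, ht n]
    have he : Φ t' = ∫⁻ x, h (s x) ⊔ ⨆ n, h (t n x) ∂ν :=
      lintegral_congr fun x => (sup_iSup_nat_succ fun n => h (t' n x)).symm
    rw [← he]
    exact (le_sSup (show Φ t' ∈ V from ⟨t', ht', rfl⟩)).trans hsup
  have hfin : Φ t ≠ ∞ := by
    refine ((lintegral_mono' (μ := ν) le_rfl fun x : Ω => iSup_le fun n => hle (t n x)).trans_lt
      (lintegral_const_lt_top (μ := ν) (c := 4) (by simp))).ne
  have hae := ae_eq_of_ae_le_of_lintegral_le (ae_of_all ν hle_sup) hfin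
    ((hmeas s).sup (Measurable.iSup fun n => hmeas (t n))).aemeasurable hint
  filter_upwards [hae] with x hx
  have hsx : h (s x) ≤ ⨆ n, h (t n x) := hx ▸ le_sup_left
  by_contra! hlt
  obtain ⟨r, hr1, hr2⟩ := EReal.lt_iff_exists_real_btwn.1 hlt
  refine (hmono (EReal.coe_lt_coe_iff.1 hr2)).not_ge (hsx.trans (iSup_le fun n => ?_))
  exact hmono.monotone (EReal.coe_le_coe_iff.1
    ((le_iSup (fun n => (t n x : EReal)) n).trans hr1.le))

/-- A family dominated by a sequence of its members with almost everywhere bounded values has a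
supremum in `L⁰(μ)`. -/
theorem exists_isLUB_of_ae_le {S : Set (Ω →ₘ[μ] ℝ)} {t : ℕ → Ω →ₘ[μ] ℝ} (ht : ∀ n, t n ∈ S)
    (hS : ∀ s ∈ S, ∀ᵐ x ∂μ, (s x : EReal) ≤ ⨆ n, (t n x : EReal))
    (hb : ∀ᵐ x ∂μ, BddAbove (range fun n => t n x)) : ∃ a, IsLUB S a := by
  have hmeas : Measurable fun x => ⨆ n, t n x := Measurable.iSup fun n => (t n).measurable
  refine ⟨mk _ hmeas.aestronglyMeasurable, fun s hs => ?_, fun b hb' => ?_⟩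
  · rw [← coeFn_le]
    filter_upwards [hS s hs, hb, coeFn_mk _ hmeas.aestronglyMeasurable] with x h1 h2 h3
    rw [h3]
    rw [← EReal.coe_le_coe_iff]
    exact h1.trans (iSup_le fun n => EReal.coe_le_coe_iff.2 (le_ciSup h2 n))
  · rw [← coeFn_le]
    have h := ae_all_iff.2 fun n => coeFn_le.2 (hb' (ht n))
    filter_upwards [h, coeFn_mk _ hmeas.aestronglyMeasurable] with x h1 h2
    rw [h2]
    exact ciSup_le h1

theorem isDedekindComplete [SigmaFinite μ] : IsDedekindComplete (Ω →ₘ[μ] ℝ) := by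
  rintro S hne ⟨b, hb⟩
  obtain ⟨t, ht, hS⟩ := exists_seq_forall_ae_le_iSup hne
  refine exists_isLUB_of_ae_le ht hS ?_
  filter_upwards [ae_all_iff.2 fun n => coeFn_le.2 (hb (ht n))] with x hx
  exact ⟨b x, forall_mem_range.2 hx⟩

/-- At almost every point, at most one value among the members of a disjoint sequence is nonzero,
so the supremum is finite. -/
theorem isLaterallyComplete [SigmaFinite μ] : IsLaterallyComplete (Ω →ₘ[μ] ℝ) := by
  rintro S hne h0 hdisj
  obtain ⟨t, ht, hS⟩ := exists_seq_forall_ae_le_iSup hne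
  refine exists_isLUB_of_ae_le ht hS ?_
  have hd : ∀ m n, ∀ᵐ x ∂μ, t m x = t n x ∨ t m x ⊓ t n x = 0 := fun m n => by
    by_cases hmn : t m = t n
    · exact ae_of_all _ fun x => Or.inl (by rw [hmn])
    · have := coeFn_inf (t m) (t n)
      rw [hdisj (ht m) (ht n) hmn] at this
      filter_upwards [this, coeFn_zero (μ := μ) (β := ℝ)] with x h1 h2
      exact Or.inr (by rw [← h1, h2]; rfl)
  filter_upwards [ae_all_iff.2 fun m => ae_all_iff.2 (hd m)] with x hx
  by_cases hpos : ∃ n, 0 < t n x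
  · obtain ⟨n, hn⟩ := hpos
    refine ⟨t n x, forall_mem_range.2 fun m => ?_⟩
    rcases hx m n with h | h
    · exact h.le
    · by_contra! hlt
      rw [inf_eq_right.2 hlt.le] at h
      exact hn.ne' h
  · push Not at hpos
    exact ⟨0, forall_mem_range.2 hpos⟩

/-- `L^∞(μ)` is an order convex subspace of `L⁰(μ)`. -/
theorem exists_linftyIncl_eq (f g : Lp ℝ ∞ μ) (y : Ω →ₘ[μ] ℝ) (hf : linftyIncl μ f ≤ y)
    (hg : y ≤ linftyIncl μ g) : ∃ x, linftyIncl μ x = y := by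
  refine ⟨⟨y, Lp.mem_Lp_iff_memLp.2 ?_⟩, rfl⟩
  refine ((Lp.memLp f).norm.add (Lp.memLp g).norm).mono' y.aestronglyMeasurable ?_
  filter_upwards [coeFn_le.2 hf, coeFn_le.2 hg] with x h1 h2
  change f x ≤ y x at h1
  change y x ≤ g x at h2
  change |y x| ≤ |f x| + |g x|
  exact abs_le.2 ⟨by linarith [neg_abs_le (f x), abs_nonneg (g x)],
    by linarith [le_abs_self (g x), abs_nonneg (f x)]⟩

theorem isMulUnit_one : IsMulUnit (1 : Ω →ₘ[μ] ℝ) := fun x => ⟨one_mul x, mul_one x⟩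

theorem linftyIncl_one : linftyIncl μ (linftyOne μ) = 1 := rfl

end MeasureTheory.AEEqFun

/-! ### The f-algebra `C^∞(K)` -/

/-- In an extremally disconnected space, a set `S` of continuous extended-real functions has a
continuous supremum `F`, which is minimal also locally: `F ≤ g` on an open set on which all members
of `S` are at most `g`. -/
theorem ContinuousMap.exists_sup_of_extremallyDisconnected {K : Type*} [TopologicalSpace K]
    [ExtremallyDisconnected K] (S : Set C(K, EReal)) :
    ∃ F : C(K, EReal), (∀ f ∈ S, f ≤ F) ∧ ∀ (g : C(K, EReal)) (U : Set K), IsOpen U →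
      (∀ f ∈ S, ∀ x ∈ U, f x ≤ g x) → ∀ x ∈ U, F x ≤ g x := by
  -- clopen sets with `{F > t} ⊆ A t ⊆ {F ≥ t}` for the supremum `F`
  let A : EReal → Set K := fun t => closure (⋃ f ∈ S, {x | t < f x})
  have hAopen : ∀ t, IsOpen (A t) := fun t => ExtremallyDisconnected.open_closure _
    (isOpen_biUnion fun f _ => isOpen_lt continuous_const f.continuous)
  have hAanti : Antitone A := fun s t hst => closure_mono
    (iUnion₂_mono fun f _ x (hx : t < f x) => hst.trans_lt hx)
  let F : K → EReal := fun x => sSup {t | x ∈ A t}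
  have hF : Continuous F := by
    rw [continuous_iff_lower_upperSemicontinuous]
    constructor
    · intro x y hy
      obtain ⟨t, ht, hyt⟩ := lt_sSup_iff.1 hy
      filter_upwards [(hAopen t).mem_nhds ht] with z hz
      exact hyt.trans_le (le_sSup hz)
    · intro x y hy
      obtain ⟨t, hxt, hty⟩ := exists_between hy
      have hx : x ∈ (A t)ᶜ := fun h => hxt.not_ge (le_sSup h)
      filter_upwards [isClosed_closure.isOpen_compl.mem_nhds hx] with z hz
      refine lt_of_le_of_lt (sSup_le fun s hs => ?_) hty
      by_contra! hst
      exact hz (hAanti hst.le hs)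
  refine ⟨⟨F, hF⟩, fun f hf x => ?_, fun g U hU hg x hx => ?_⟩
  · refine le_of_forall_lt fun t ht => ?_
    obtain ⟨s, hts, hs⟩ := exists_between ht
    exact hts.trans_le (le_sSup (subset_closure (mem_biUnion hf hs)))
  · refine sSup_le fun s hs => ?_
    by_contra! hgs
    obtain ⟨z, ⟨hzU, hzs⟩, hzA⟩ := mem_closure_iff.1 hs (U ∩ {z | g z < s})
      (hU.inter (isOpen_lt g.continuous continuous_const)) ⟨hx, hgs⟩
    obtain ⟨f, hf, hfz⟩ := mem_iUnion₂.1 hzA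
    exact (hfz.trans_le (hg f hf z hzU)).not_gt hzs

namespace CInfty

section

variable {K : Type*} [TopologicalSpace K]

theorem zero_apply [CompactSpace K] [T2Space K] [ExtremallyDisconnected K] (x : K) :
    (0 : CInfty K) x = 0 := rfl

theorem le_iff_eventually_toReal_le {f g : CInfty K} :
    f ≤ g ↔ (fun x => (f x).toReal) ≤ᶠ[denseFilter K] fun x => (g x).toReal := by
  have hfin := mem_denseFilter (f.isOpen_fin.inter g.isOpen_fin) (f.dense_inter g)
  constructor
  · intro h
    filter_upwards [hfin] with x hx
    exact EReal.toReal_le_toReal (h x) hx.1.1 hx.2.2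
  · intro h
    have hd : Dense {x | f x ≤ g x} := by
      refine Dense.mono (fun x hx => ?_) (Dense.mono interior_subset (inter_mem h hfin))
      obtain ⟨hx, hf, hg⟩ := hx
      change f x ≤ g x
      rw [← coe_toReal hf, ← coe_toReal hg]
      exact EReal.coe_le_coe_iff.2 hx
    intro x
    have hcl : IsClosed {x | f x ≤ g x} := isClosed_le f.1.continuous g.1.continuous
    have : x ∈ {x | f x ≤ g x} := by
      rw [← hcl.closure_eq]
      exact hd x
    exact this

/-- A set in `C^∞(K)` has a supremum as soon as its supremum among the continuous extended-real
functions is finite on a dense set. -/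
theorem exists_isLUB [ExtremallyDisconnected K] (S : Set (CInfty K))
    (h : ∀ F : C(K, EReal), (∀ f ∈ S, ∀ x, f x ≤ F x) → (∀ (g : CInfty K) (U : Set K), IsOpen U →
      (∀ f ∈ S, ∀ x ∈ U, f x ≤ g x) → ∀ x ∈ U, F x ≤ g x) → Dense {x | F x ≠ ⊥ ∧ F x ≠ ⊤}) :
    ∃ a, IsLUB S a := by
  obtain ⟨F, hF, hmin⟩ :=
    ContinuousMap.exists_sup_of_extremallyDisconnected (Subtype.val '' S : Set C(K, EReal))
  have hF' : ∀ f ∈ S, ∀ x, f x ≤ F x := fun f hf => hF f.1 ⟨f, hf, rfl⟩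
  have hmin' : ∀ (g : CInfty K) (U : Set K), IsOpen U →
      (∀ f ∈ S, ∀ x ∈ U, f x ≤ g x) → ∀ x ∈ U, F x ≤ g x := fun g U hU hg =>
    hmin g.1 U hU (by rintro _ ⟨f, hf, rfl⟩; exact hg f hf)
  exact ⟨⟨F, h F hF' hmin'⟩, hF', fun g hg x =>
    hmin' g univ isOpen_univ (fun f hf x _ => hg hf x) x (mem_univ x)⟩

theorem isDedekindComplete [ExtremallyDisconnected K] : IsDedekindComplete (CInfty K) := by
  rintro S ⟨s, hs⟩ ⟨b, hb⟩
  refine exists_isLUB S fun F hF hmin => (s.dense_inter b).mono fun x hx => ⟨?_, ?_⟩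
  · exact ne_bot_of_le_ne_bot hx.1.1 (hF s hs x)
  · exact ne_top_of_le_ne_top hx.2.2
      (hmin b univ isOpen_univ (fun f hf x _ => hb hf x) x (mem_univ x))

end

variable {K : Type*} [TopologicalSpace K] [CompactSpace K] [T2Space K] [ExtremallyDisconnected K]

/-- On the open set where one member of a disjoint family is positive, the supremum of the family is
that member, and where all members vanish it is `0`; so it cannot be infinite on an open set. -/
theorem isLaterallyComplete : IsLaterallyComplete (CInfty K) := by
  rintro S ⟨s, hs⟩ h0 hdisj
  refine exists_isLUB S fun F hF hmin => ?_
  have hbot : ∀ x, F x ≠ ⊥ := fun x =>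
    ne_bot_of_le_ne_bot EReal.zero_ne_bot ((h0 s hs x).trans (hF s hs x))
  refine dense_iff_inter_open.2 fun V hV hVne => ?_
  by_contra hcon
  have htop : ∀ x ∈ V, F x = ⊤ := fun x hx => by
    by_contra hne
    exact hcon ⟨x, hx, hbot x, hne⟩
  by_cases hpos : ∃ f ∈ S, ∃ x ∈ V, 0 < f x
  · obtain ⟨f, hf, x, hxV, hx⟩ := hpos
    have hU : IsOpen (V ∩ {x | 0 < f x}) :=
      hV.inter (isOpen_lt continuous_const f.1.continuous)
    obtain ⟨z, hz, hzfin⟩ := f.dense_fin.inter_open_nonempty _ hU ⟨x, hxV, hx⟩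
    refine hzfin.2 (top_le_iff.1 ((htop z hz.1).ge.trans ?_))
    refine hmin f _ hU (fun g hg w hw => ?_) z hz
    by_cases hgf : g = f
    · rw [hgf]
    · have h1 : g w ⊓ f w = 0 := by
        rw [← inf_apply, hdisj hg hf hgf, zero_apply]
      by_contra! hlt
      rw [inf_eq_right.2 hlt.le] at h1
      exact hw.2.ne' h1
  · push Not at hpos
    obtain ⟨x, hx⟩ := hVne
    have := hmin 0 V hV (fun f hf x hx => hpos f hf x hx) x hx
    rw [htop x hx, zero_apply] at this
    exact EReal.zero_ne_top (top_le_iff.1 this)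

instance : IsFAlgebra (CInfty K) := by
  refine IsFAlgebra.of_eventually (l := denseFilter K) (fun f x => (f x).toReal)
    le_iff_eventually_toReal_le (Eventually.of_forall fun x => rfl)
    (fun f g => Germ.coe_eq.1 (toGerm_add f g)) (fun f g => Germ.coe_eq.1 (toGerm_mul f g))
    (fun r f => Germ.coe_eq.1 (toGerm_smul r f)) fun f g => ?_
  filter_upwards [mem_denseFilter (f.isOpen_fin.inter g.isOpen_fin) (f.dense_inter g)] with x hx
  rw [Pi.inf_apply, inf_apply, ← EReal.coe_eq_coe_iff]
  rcases le_total (f x) (g x) with h | h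
  · rw [inf_eq_left.2 h, inf_eq_left.2 (EReal.toReal_le_toReal h hx.1.1 hx.2.2)]
  · rw [inf_eq_right.2 h, inf_eq_right.2 (EReal.toReal_le_toReal h hx.2.1 hx.1.2)]

theorem isMulUnit_incl_one : IsMulUnit (incl K 1) := fun f => by
  have h : toGerm (incl K 1) = 1 := rfl
  exact ⟨toGerm_injective (by rw [toGerm_mul, h, one_mul]),
    toGerm_injective (by rw [toGerm_mul, h, mul_one])⟩

theorem incl_le_incl_iff {f g : C(K, ℝ)} : incl K f ≤ incl K g ↔ f ≤ g :=
  forall_congr' fun _ => EReal.coe_le_coe_iff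

/-- `C(K)` is an order convex subspace of `C^∞(K)`. -/
theorem exists_incl_eq (f g : C(K, ℝ)) (y : CInfty K) (hf : incl K f ≤ y) (hg : y ≤ incl K g) :
    ∃ x, incl K x = y := by
  have hfin : ∀ x, x ∈ y.fin := fun x =>
    ⟨ne_bot_of_le_ne_bot (EReal.coe_ne_bot (f x)) (hf x),
      ne_top_of_le_ne_top (EReal.coe_ne_top (g x)) (hg x)⟩
  refine ⟨⟨fun x => (y x).toReal, ?_⟩, ext_of_dense dense_univ fun x _ => coe_toReal (hfin x)⟩
  rw [← continuousOn_univ]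
  exact y.continuousOn_toReal.mono fun x _ => hfin x

end CInfty

/-! ### Subalgebras of universal completions -/

theorem mainTheorem4 :
    (∀ (L : Type*) [AddCommGroup L] [Module ℝ L] [Lattice L] [IsVectorLattice L]
      (M : Type*) [NonUnitalRing M] [Module ℝ M] [Lattice M] [IsFAlgebra M]
      (ι : L →ₗ[ℝ] M) (e : L),
      IsDedekindComplete L → IsWeakOrderUnit e → IsUniversalCompletion ι → IsMulUnit (ι e) →
      ∀ B : NonUnitalSubalgebra ℝ M, (∀ x ∈ principalIdeal e, ι x ∈ B) →
        IsDedekindCompleteFAlgebraWithUnit B (ι e)) ∧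
    (∀ (Ω : Type*) [MeasurableSpace Ω] (μ : Measure Ω) [SigmaFinite μ],
      (IsVectorLattice (Lp ℝ ∞ μ) ∧ IsDedekindComplete (Lp ℝ ∞ μ) ∧
        IsWeakOrderUnit (linftyOne μ) ∧ IsUniversalCompletion (linftyIncl μ) ∧
        IsFAlgebra (Ω →ₘ[μ] ℝ) ∧ linftyIncl μ (linftyOne μ) = 1) ∧
      ∀ B : NonUnitalSubalgebra ℝ (Ω →ₘ[μ] ℝ), (∀ f : Lp ℝ ∞ μ, linftyIncl μ f ∈ B) →
        IsDedekindCompleteFAlgebraWithUnit B 1) ∧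
    (∀ (K : Type*) [TopologicalSpace K] [CompactSpace K] [T2Space K] [ExtremallyDisconnected K],
      (IsVectorLattice C(K, ℝ) ∧ IsDedekindComplete C(K, ℝ) ∧
        IsWeakOrderUnit (1 : C(K, ℝ)) ∧ IsUniversalCompletion (CInfty.incl K) ∧
        IsFAlgebra (CInfty K) ∧ IsMulUnit (CInfty.incl K 1)) ∧
      ∀ B : NonUnitalSubalgebra ℝ (CInfty K), (∀ f : C(K, ℝ), CInfty.incl K f ∈ B) →
        IsDedekindCompleteFAlgebraWithUnit B (CInfty.incl K 1)) := by
  refine ⟨?_, ?_, ?_⟩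
  · intro L _ _ _ _ M _ _ _ _ ι e hL he hι hu B hB
    exact IsUniversalCompletion.isDedekindCompleteFAlgebraWithUnit hL he.1 hι hu B hB
  · intro Ω _ μ _
    have hu : IsMulUnit (linftyIncl μ (linftyOne μ)) := AEEqFun.isMulUnit_one
    obtain ⟨h1, h2, h3, h4⟩ := IsFAlgebra.isUniversalCompletion_of_ordConnected
      AEEqFun.isDedekindComplete AEEqFun.isLaterallyComplete hu Iff.rfl
      AEEqFun.exists_linftyIncl_eq
    exact ⟨⟨h1, h2, h3, h4, inferInstance, AEEqFun.linftyIncl_one⟩, fun B hB =>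
      IsUniversalCompletion.isDedekindCompleteFAlgebraWithUnit h2 h3.1 h4 hu B fun x _ => hB x⟩
  · intro K _ _ _ _
    have hu := CInfty.isMulUnit_incl_one (K := K)
    obtain ⟨h1, h2, h3, h4⟩ := IsFAlgebra.isUniversalCompletion_of_ordConnected
      CInfty.isDedekindComplete CInfty.isLaterallyComplete hu CInfty.incl_le_incl_iff
      CInfty.exists_incl_eq
    exact ⟨⟨h1, h2, h3, h4, inferInstance, hu⟩, fun B hB =>
      IsUniversalCompletion.isDedekindCompleteFAlgebraWithUnit h2 h3.1 h4 hu B fun x _ => hB x⟩
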